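/- There is a constant $\alpha>0$ such that for every $k\in\mathbb N$ and $K\in\mathbb R$ there are $c>0$ and $n_0\in\mathbb N$ such that the following holds for all $n\ge n_0$ and all $p\in[0,1]$ with $$\alpha\,\frac{\ln n}{n}\;\le\; p\;\le\; K\,\frac{(\ln n)^k}{n}.$$ Let $B=(V\cup C,E_B)$ be the random bipartite graph with $|V|=|C|=n$ in which each pair $(v,c)\in V\times C$ is an edge independently with probability $p$. Consider any randomized algorithm in the LOCAL model on the network $B$: every node has a unique identifier (fixed independently of the random edges and of the algorithm's randomness) and a private source of randomness, initially knows only these and the identifiers of its neighbors, and in each synchronous round it exchanges messages of arbitrary size with its neighbors and performs arbitrary local computation (the algorithm may depend on $n$, $p$ and on the identifier assignment). Suppose that after $T$ rounds each node outputs the identifier of its matching partner, and that with probability at least $2/3$ (over the random graph and the algorithm's randomness) the outputs are consistent and form a perfect matching of $B$. Then $$T\;\ge\; c\,\frac{\ln n}{\ln\ln n}.$$ In other words, any randomized LOCAL algorithm that computes a perfect matching of $B$ with probability at least $2/3$ requires $\Omega(\log n/\log\log n)$ rounds. -/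

import Mathlib

open MeasureTheory ProbabilityTheory

/-- The bipartite graph on the disjoint union of `V` and `C` whose edges are the pairs in `E`. -/
def bipartiteGraph {V C : Type*} (E : Set (V × C)) : SimpleGraph (V ⊕ C) where
  Adj x y := ∃ e ∈ E, (x = Sum.inl e.1 ∧ y = Sum.inr e.2) ∨ (x = Sum.inr e.2 ∧ y = Sum.inl e.1)
  symm := ⟨by
    rintro x y ⟨e, he, h⟩
    exact ⟨e, he, h.symm.imp And.symm And.symm⟩⟩
  loopless := ⟨by
    rintro x ⟨e, -, ⟨h, h'⟩ | ⟨h, h'⟩⟩ <;> simp [h] at h'⟩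

/-- A (randomized) algorithm of the LOCAL model: the program that every node runs, with private
random tape in `Ω`, local states in `S` and messages in `M`. States and messages are unrestricted
(unbounded message size, unbounded local computation). Identifiers are natural numbers. -/
structure LocalAlgorithm (Ω S M : Type*) where
  /-- Initial state of a node, from its identifier, the identifiers of its neighbors, and its
  private random tape (all random choices the node ever makes). -/
  init : ℕ → Set ℕ → Ω → S
  /-- The message that a node in a given state sends to its neighbor with a given identifier. -/
  send : S → ℕ → M
  /-- The new state of a node, from its old state and the messages received in the round, each
  tagged with the identifier of its sender. -/
  receive : S → Set (ℕ × M) → S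
  /-- The output of a node: the identifier of the node that it declares to be matched to. -/
  output : S → ℕ

namespace LocalAlgorithm

variable {Ω S M N : Type*}

/-- The state of each node of the network `G` after `t` synchronous rounds, where `ident` gives
the identifiers and `ω` the random tapes of the nodes. In every round each node sends one message
to each of its neighbors and then updates its state with the messages from its neighbors. -/
def state (A : LocalAlgorithm Ω S M) (G : SimpleGraph N) (ident : N → ℕ) (ω : N → Ω) :
    ℕ → N → S
  | 0, v => A.init (ident v) (ident '' G.neighborSet v) (ω v)
  | t + 1, v => A.receive (A.state G ident ω t v)
      {im | ∃ u, G.Adj v u ∧ im = (ident u, A.send (A.state G ident ω t u) (ident v))}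

/-- The output of each node when the algorithm is run for `T` rounds. -/
def run (A : LocalAlgorithm Ω S M) (T : ℕ) (G : SimpleGraph N) (ident : N → ℕ) (ω : N → Ω)
    (v : N) : ℕ :=
  A.output (A.state G ident ω T v)

end LocalAlgorithm

/-- The outputs `out` of the nodes are consistent and describe a perfect matching of `G`: there is
a perfect matching of `G` such that every node outputs the identifier of its partner. -/
def OutputsPerfectMatching {N : Type*} (G : SimpleGraph N) (ident : N → ℕ) (out : N → ℕ) : Prop :=
  ∃ P : G.Subgraph, P.IsPerfectMatching ∧ ∀ v u, P.Adj v u → out v = ident u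

/-- The probability that the `T`-round run of `A` computes a perfect matching of the random
bipartite graph on `n + n` nodes. Each of the `n * n` possible edges is present independently with
probability `p`, and the nodes have independent random tapes of law `ρ`, independent of the
graph. -/
noncomputable def perfectMatchingProb {Ω S M : Type*} [MeasurableSpace Ω] (ρ : Measure Ω)
    (A : LocalAlgorithm Ω S M) (T n : ℕ) (p : unitInterval) (ident : Fin n ⊕ Fin n → ℕ) : ℝ :=
  ((setBernoulli (Set.univ : Set (Fin n × Fin n)) p).prod
      (Measure.pi fun _ : Fin n ⊕ Fin n => ρ)).real
    {x | OutputsPerfectMatching (bipartiteGraph x.1) ident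
      (A.run T (bipartiteGraph x.1) ident x.2)}

/-! ### Product structure and moments of the random edge set. -/

section SetBernoulli
variable {ι : Type*} (p : unitInterval)

/-! Fix a set `K` of `m` nodes of `V` and a further node `u`. Delete all edges at `K` and `u`, and
let `W` be the neighborhood of `K`. The nodes of `K` must be matched into `W`, so the surplus `m`
flows outward through the ball around `W` in the remaining graph. Counting the matching edges that
cross the ball's boundary recovers `m` (`card_eq_matchingExcess`). The boundary is too far from `W`
for `T` rounds to reveal what was deleted, so the count is a function of the remaining graph and `W`
alone, unless `u` has an edge into a slightly larger ball.

Replacing `K` by `insert u K`, the same function must return `m + 1`. But the remaining graph is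
independent of the neighborhood, and the neighborhoods of `m` and of `m + 1` nodes are close in
total variation (`setBernoulli_real_add_le`). The function cannot give both answers reliably, so the
success probability is at most `1 / 2` plus small errors
(`two_mul_setBernoulli_real_outputsPerfectMatching_le`). The errors are small as long as the ball
has far fewer than `1 / p` nodes, which holds for `T` below a multiple of `log n / log log n` since
degrees are polylogarithmic. All this holds for each fixed choice of tapes, so randomness does not
help. -/

lemma map_mem_setBernoulli :
    (setBernoulli (Set.univ : Set ι) p).map (fun E i => i ∈ E) =
      Measure.infinitePi fun _ : ι =>
        unitInterval.toNNReal p • Measure.dirac True +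
          unitInterval.toNNReal (unitInterval.symm p) • Measure.dirac False := by
  have h : Measurable fun q : ι → Prop => {i | q i} := MeasurableEquiv.setOfPred.measurable
  rw [setBernoulli_eq_map, Measure.map_map (by fun_prop) h]
  simp [Function.comp_def]

lemma map_eval_setBernoulli (i : ι) :
    (setBernoulli (Set.univ : Set ι) p).map (fun E => i ∈ E) =
      unitInterval.toNNReal p • Measure.dirac True +
        unitInterval.toNNReal (unitInterval.symm p) • Measure.dirac False := by
  have h := Measure.infinitePi_map_eval (fun _ : ι =>
        unitInterval.toNNReal p • Measure.dirac True +
          unitInterval.toNNReal (unitInterval.symm p) • Measure.dirac False) i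
  rw [← map_mem_setBernoulli, Measure.map_map (by fun_prop) (by fun_prop)] at h
  exact h

lemma iIndepFun_mem_setBernoulli :
    iIndepFun (fun (i : ι) (E : Set ι) => i ∈ E) (setBernoulli (Set.univ : Set ι) p) := by
  rw [iIndepFun_iff_map_fun_eq_infinitePi_map (fun i => by fun_prop), map_mem_setBernoulli]
  simp_rw [map_eval_setBernoulli]

lemma setBernoulli_real_mem (i : ι) : (setBernoulli Set.univ p).real {E : Set ι | i ∈ E} = p := by
  have h := congrArg (fun μ => μ {True}) (map_eval_setBernoulli p i)
  beta_reduce at h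
  rw [Measure.map_apply (by fun_prop) (by simp)] at h
  have h' : (fun E : Set ι => i ∈ E) ⁻¹' {True} = {E | i ∈ E} := by ext; simp
  rw [measureReal_def, ← h', h]
  simp

variable [Fintype ι]

lemma setBernoulli_real_inter_eq_mul {X Y : Set (Set ι)} (S : Set ι)
    (hX : ∀ E E' : Set ι, (∀ i ∈ S, i ∈ E ↔ i ∈ E') → E ∈ X → E' ∈ X)
    (hY : ∀ E E' : Set ι, (∀ i ∉ S, i ∈ E ↔ i ∈ E') → E ∈ Y → E' ∈ Y) :
    (setBernoulli Set.univ p).real (X ∩ Y) =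
      (setBernoulli Set.univ p).real X * (setBernoulli Set.univ p).real Y := by
  classical
  have h := (iIndepFun_mem_setBernoulli (ι := ι) p).indepFun_finset S.toFinset Sᶜ.toFinset
    (by rw [Set.disjoint_toFinset]; exact disjoint_compl_right) (fun i => by fun_prop)
  have h1 : X = (fun (E : Set ι) (i : S.toFinset) => (i : ι) ∈ E) ⁻¹'
      ((fun (E : Set ι) (i : S.toFinset) => (i : ι) ∈ E) '' X) := by
    refine Set.Subset.antisymm (Set.subset_preimage_image _ _) ?_
    rintro E ⟨E', hE', h⟩
    refine hX E' E (fun i hi => ?_) hE'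
    simpa using congrFun h ⟨i, by simpa using hi⟩
  have h2 : Y = (fun (E : Set ι) (i : Sᶜ.toFinset) => (i : ι) ∈ E) ⁻¹'
      ((fun (E : Set ι) (i : Sᶜ.toFinset) => (i : ι) ∈ E) '' Y) := by
    refine Set.Subset.antisymm (Set.subset_preimage_image _ _) ?_
    rintro E ⟨E', hE', h⟩
    refine hY E' E (fun i hi => ?_) hE'
    simpa using congrFun h ⟨i, by simpa using hi⟩
  rw [h1, h2, measureReal_def, measureReal_def, measureReal_def,
    h.measure_inter_preimage_eq_mul _ _ .of_discrete .of_discrete, ENNReal.toReal_mul]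

lemma sum_set_prod_ite [DecidableEq ι] (f g : ι → ℝ) :
    ∑ s : Finset ι, ∏ i, (if i ∈ s then f i else g i) = ∏ i, (f i + g i) := by
  rw [Finset.prod_add, Finset.powerset_univ]
  refine Finset.sum_congr rfl fun s _ => ?_
  rw [Finset.prod_ite]
  congr 2 <;> ext <;> simp

lemma setBernoulli_real_singleton_eq_prod [DecidableEq ι] (s : Finset ι) :
    (setBernoulli Set.univ p).real {(s : Set ι)} = ∏ i, if i ∈ s then (p : ℝ) else 1 - p := by
  rw [setBernoulli_real_singleton p (Set.subset_univ _) Set.finite_univ, Finset.prod_ite]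
  simp [← Set.compl_eq_univ_sdiff, Set.ncard_eq_toFinset_card', Finset.filter_not,
    Finset.compl_eq_univ_sdiff]

lemma integral_setBernoulli_two_pow (S : Set ι) :
    ∫ E : Set ι, (2 : ℝ) ^ (E ∩ S).ncard ∂setBernoulli Set.univ p = (1 + p) ^ S.ncard := by
  classical
  rw [integral_fintype .of_finite, ← Fintype.finsetEquivSet.sum_comp]
  calc _ = ∑ s : Finset ι, ∏ i, (if i ∈ s then (if i ∈ S then (2 * p : ℝ) else p)
        else 1 - p) := by
        refine Finset.sum_congr rfl fun s _ => ?_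
        have : (2 : ℝ) ^ ((s : Set ι) ∩ S).ncard = ∏ i, if i ∈ s ∧ i ∈ S then (2 : ℝ) else 1 := by
          rw [Finset.prod_ite]
          simp [Set.ncard_eq_toFinset_card']
          congr 1
          ext; simp
        rw [Fintype.finsetEquivSet_apply, this, setBernoulli_real_singleton_eq_prod, smul_eq_mul,
          ← Finset.prod_mul_distrib]
        refine Finset.prod_congr rfl fun i _ => ?_
        by_cases h : i ∈ s <;> by_cases h' : i ∈ S <;> simp [h, h', mul_comm]
    _ = _ := by
        rw [sum_set_prod_ite]
        have : ∀ i, ((if i ∈ S then (2 * p : ℝ) else p) + (1 - p)) =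
            if i ∈ S then (1 + p : ℝ) else 1 := by
          intro i; split_ifs <;> ring
        simp_rw [this]
        rw [Finset.prod_ite]
        simp [Set.ncard_eq_toFinset_card']

/-- Markov's inequality for `2 ^ X`, a crude Chernoff bound that suffices for the degrees. -/
lemma setBernoulli_real_lt_ncard_inter_le (S : Set ι) (k : ℕ) :
    (setBernoulli Set.univ p).real {E : Set ι | k < (E ∩ S).ncard} ≤
      (1 + p) ^ S.ncard / 2 ^ k := by
  rw [le_div_iff₀ (by positivity), ← integral_setBernoulli_two_pow, mul_comm]
  refine le_trans ?_ (mul_meas_ge_le_integral_of_nonneg (.of_forall fun E => by positivity)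
    .of_finite ((2 : ℝ) ^ k))
  refine mul_le_mul_of_nonneg_left (measureReal_mono fun E hE => ?_) (by positivity)
  exact pow_le_pow_right₀ (one_le_two (α := ℝ)) (le_of_lt hE)
end SetBernoulli

/-! ### Balls in a graph and locality of the algorithm. -/

section Reach
variable {N : Type*}

/-- The set of nodes at distance at most `j` from `W` in `G`. -/
def SimpleGraph.reach (G : SimpleGraph N) (W : Set N) : ℕ → Set N
  | 0 => W
  | j + 1 => G.reach W j ∪ {y | ∃ x ∈ G.reach W j, G.Adj x y}

variable {G H : SimpleGraph N} {W : Set N}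

lemma SimpleGraph.reach_mono : Monotone (G.reach W) :=
  monotone_nat_of_le_succ fun _ => Set.subset_union_left

lemma SimpleGraph.mem_reach_succ_of_adj {j : ℕ} {x y : N} (hx : x ∈ G.reach W j)
    (h : G.Adj x y) : y ∈ G.reach W (j + 1) :=
  Or.inr ⟨x, hx, h⟩

lemma SimpleGraph.ncard_reach_le [Finite N] {d : ℕ} (hd : ∀ x, (G.neighborSet x).ncard ≤ d)
    (j : ℕ) : (G.reach W j).ncard ≤ W.ncard * (d + 1) ^ j := by
  induction j with
  | zero => simp [reach]
  | succ j ih =>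
    have h : {y | ∃ x ∈ G.reach W j, G.Adj x y} =
        ⋃ x ∈ (Set.toFinite (G.reach W j)).toFinset, G.neighborSet x := by
      ext; simp
    calc _ ≤ (G.reach W j).ncard + {y | ∃ x ∈ G.reach W j, G.Adj x y}.ncard :=
          Set.ncard_union_le _ _
      _ ≤ (G.reach W j).ncard + (G.reach W j).ncard * d := by
          gcongr
          rw [h]
          refine (Finset.set_ncard_biUnion_le _ _).trans ?_
          refine (Finset.sum_le_card_nsmul _ _ d fun x _ => hd x).trans ?_
          rw [← Set.ncard_eq_toFinset_card, smul_eq_mul]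
      _ = (G.reach W j).ncard * (d + 1) := by ring
      _ ≤ _ := by rw [pow_succ, ← mul_assoc]; gcongr

/-- If two graphs agree around all nodes of the `D`-ball of `W` in `H` outside of `W`, then the
states of an algorithm after `t` rounds agree at all nodes of the `(D - t)`-ball outside of the
`t`-ball. -/
lemma LocalAlgorithm.state_eq_of_adj_iff {Ω S M : Type*} (A : LocalAlgorithm Ω S M)
    (ident : N → ℕ) (ω : N → Ω) {D : ℕ}
    (hadj : ∀ y ∈ H.reach W D, y ∉ W → ∀ z, G.Adj y z ↔ H.Adj y z) :
    ∀ t ≤ D, ∀ y ∈ H.reach W (D - t), y ∉ H.reach W t →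
      A.state G ident ω t y = A.state H ident ω t y := by
  intro t
  induction t with
  | zero =>
    intro _ y hy hy'
    have : G.neighborSet y = H.neighborSet y := by ext z; exact hadj y hy hy' z
    simp [state, this]
  | succ t ih =>
    intro ht y hy hy'
    have h0 : y ∉ W := fun h => hy' (SimpleGraph.reach_mono (Nat.zero_le (t + 1)) h)
    have hadj' := hadj y (SimpleGraph.reach_mono (by omega) hy) h0
    simp only [state]
    rw [ih (by omega) y (SimpleGraph.reach_mono (by omega) hy)
      fun h => hy' (SimpleGraph.reach_mono (by omega) h)]
    congr 1
    ext im
    simp only [Set.mem_ofPred_eq]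
    refine exists_congr fun z => ?_
    rw [hadj' z]
    refine and_congr_right fun hz => ?_
    -- Both margins shrink by one per round: a neighbor of `y` lies at most one step further out,
    -- and at most one step closer to `W`.
    rw [ih (by omega) z]
    · have := SimpleGraph.mem_reach_succ_of_adj hy hz
      rwa [show D - (t + 1) + 1 = D - t by omega] at this
    · exact fun h => hy' (SimpleGraph.mem_reach_succ_of_adj h hz.symm)

end Reach

/-! ### Recovering the number of deleted nodes from the flow out of a ball. -/

section Flow
variable {V C : Type*}

lemma bipartiteGraph_adj_inl_inr {E : Set (V × C)} {v : V} {c : C} :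
    (bipartiteGraph E).Adj (Sum.inl v) (Sum.inr c) ↔ (v, c) ∈ E := by
  simp [bipartiteGraph]

lemma bipartiteGraph_adj_inr_inl {E : Set (V × C)} {v : V} {c : C} :
    (bipartiteGraph E).Adj (Sum.inr c) (Sum.inl v) ↔ (v, c) ∈ E := by
  simp [bipartiteGraph]

lemma not_bipartiteGraph_adj_inl_inl {E : Set (V × C)} {v w : V} :
    ¬ (bipartiteGraph E).Adj (Sum.inl v) (Sum.inl w) := by
  simp [bipartiteGraph]

lemma not_bipartiteGraph_adj_inr_inr {E : Set (V × C)} {c d : C} :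
    ¬ (bipartiteGraph E).Adj (Sum.inr c) (Sum.inr d) := by
  simp [bipartiteGraph]

lemma OutputsPerfectMatching.exists_equiv {E : Set (V × C)} {ident out : V ⊕ C → ℕ}
    (h : OutputsPerfectMatching (bipartiteGraph E) ident out) :
    ∃ e : V ≃ C, (∀ v, (v, e v) ∈ E) ∧ (∀ v, out (Sum.inl v) = ident (Sum.inr (e v))) ∧
      ∀ c, out (Sum.inr c) = ident (Sum.inl (e.symm c)) := by
  obtain ⟨P, ⟨hm, hs⟩, ho⟩ := h
  have hf : ∀ v, ∃ c, P.Adj (Sum.inl v) (Sum.inr c) := by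
    intro v
    obtain ⟨w, hw, -⟩ := hm (hs (Sum.inl v))
    rcases w with w | c
    · exact (not_bipartiteGraph_adj_inl_inl hw.adj_sub).elim
    · exact ⟨c, hw⟩
  have hg : ∀ c, ∃ v, P.Adj (Sum.inr c) (Sum.inl v) := by
    intro c
    obtain ⟨w, hw, -⟩ := hm (hs (Sum.inr c))
    rcases w with w | d
    · exact ⟨w, hw⟩
    · exact (not_bipartiteGraph_adj_inr_inr hw.adj_sub).elim
  choose f hf using hf
  choose g hg using hg
  refine ⟨⟨f, g, fun v => ?_, fun c => ?_⟩, fun v => bipartiteGraph_adj_inl_inr.1 (hf v).adj_sub,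
    fun v => ho _ _ (hf v), fun c => ho _ _ (hg c)⟩
  · exact Sum.inl_injective ((hm (hs _)).unique (hg (f v)) (hf v).symm)
  · exact Sum.inr_injective ((hm (hs _)).unique (hf (g c)) (hg c).symm)

open Classical in
/-- The excess of the number of nodes of `V` over the number of nodes of `C` that must be
adjoined to the `r`-ball of `W` if the outputs `out` on its boundary describe a perfect matching. -/
noncomputable def matchingExcess [Fintype V] [Fintype C] (r : ℕ) (ident out : V ⊕ C → ℕ)
    (H : SimpleGraph (V ⊕ C)) (W : Set (V ⊕ C)) : ℤ :=
  ({v : V | Sum.inl v ∈ H.reach W (r + 1) ∧ Sum.inl v ∉ H.reach W r ∧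
      out (Sum.inl v) ∉ ident '' H.reach W (r + 1)} : Finset V).card -
  ({c : C | Sum.inr c ∈ H.reach W (r + 1) ∧ Sum.inr c ∉ H.reach W r ∧
      out (Sum.inr c) ∉ ident '' H.reach W (r + 1)} : Finset C).card -
  (({v : V | Sum.inl v ∈ H.reach W (r + 1)} : Finset V).card -
    ({c : C | Sum.inr c ∈ H.reach W (r + 1)} : Finset C).card)

/-- The pairs matched inside `S × R` contribute equally to both cardinalities and cancel. -/
lemma card_sub_card_eq_of_equiv [Fintype V] [Fintype C] [DecidableEq V] [DecidableEq C]
    (e : V ≃ C) (S : Finset V) (R : Finset C) :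
    (S.card : ℤ) - R.card =
      {v ∈ S | e v ∉ R}.card - {c ∈ R | e.symm c ∉ S}.card := by
  have h1 := Finset.card_filter_add_card_filter_not (s := S) (fun v => e v ∈ R)
  have h2 := Finset.card_filter_add_card_filter_not (s := R) (fun c => e.symm c ∈ S)
  have h3 : {v ∈ S | e v ∈ R}.card = {c ∈ R | e.symm c ∈ S}.card := by
    refine Finset.card_bij (fun v _ => e v) ?_ (fun _ _ _ _ h => e.injective h) ?_
    · simp +contextual
    · intro c hc
      exact ⟨e.symm c, by simpa [and_comm] using hc, by simp⟩
  omega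

/-- Conservation of matching edges on the `(T + 1)`-ball of `W` together with `K`: an edge leaving
this set has its inner end outside the `T`-ball, where the runs on `E` and `E'` give the same
output. Two sets `K ⊆ K'` are needed because the edges of `u` are deleted in both comparisons, while
`u` counts towards `K` in only one. -/
theorem card_eq_matchingExcess [Fintype V] [Fintype C] {Ω S M : Type*}
    (A : LocalAlgorithm Ω S M) (T : ℕ) {ident : V ⊕ C → ℕ} (hident : ident.Injective)
    (ω : V ⊕ C → Ω) {E E' : Set (V × C)} {K K' : Finset V} {W : Set C} (hE' : E' ⊆ E)
    (hKK' : K ⊆ K') (hK' : ∀ e ∈ E', e.1 ∉ K')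
    (hE : ∀ e ∈ E, e ∉ E' → (e.1 ∈ K ∧ e.2 ∈ W) ∨ (e.1 ∈ K' ∧ e.1 ∉ K ∧
      Sum.inr e.2 ∉ (bipartiteGraph E').reach (Sum.inr '' W) (2 * T + 2)))
    (h : OutputsPerfectMatching (bipartiteGraph E) ident
      (A.run T (bipartiteGraph E) ident ω)) :
    (K.card : ℤ) = matchingExcess T ident (A.run T (bipartiteGraph E') ident ω)
      (bipartiteGraph E') (Sum.inr '' W) := by
  classical
  obtain ⟨e, heE, heV, heC⟩ := h.exists_equiv
  set H := bipartiteGraph E' with hH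
  set B := H.reach (Sum.inr '' W) with hB
  have hmono : Monotone B := SimpleGraph.reach_mono
  have hB0 : ∀ c ∈ W, ∀ j, Sum.inr c ∈ B j := fun c hc j =>
    hmono (Nat.zero_le j) (Set.mem_image_of_mem _ hc)
  -- The nodes of `K'` are isolated in `E'`, and the ball starts from nodes of `C`.
  have hKB : ∀ v ∈ K', ∀ j, Sum.inl v ∉ B j := by
    intro v hv j
    induction j with
    | zero => simp [hB, SimpleGraph.reach]
    | succ j ih =>
      rintro (h | ⟨x | c, -, h⟩)
      · exact ih h
      · exact not_bipartiteGraph_adj_inl_inl h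
      · exact hK' _ (bipartiteGraph_adj_inr_inl.1 h) hv
  -- edges of `E` at the ball
  have hV : ∀ v c j, Sum.inl v ∈ B j → (v, c) ∈ E → (v, c) ∈ E' := by
    intro v c j hv hvc
    by_contra hn
    rcases hE _ hvc hn with h | h
    · exact hKB v (hKK' h.1) _ hv
    · exact hKB v h.1 _ hv
  have hC : ∀ v c, Sum.inr c ∈ B (2 * T + 2) → v ∉ K → (v, c) ∈ E → (v, c) ∈ E' := by
    intro v c hc hv hvc
    by_contra hn
    rcases hE _ hvc hn with h | h
    · exact hv h.1
    · exact h.2.2 hc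
  have hKW : ∀ v c, v ∈ K → (v, c) ∈ E → c ∈ W := by
    intro v c hv hvc
    rcases hE _ hvc (fun h => hK' _ h (hKK' hv)) with h | h
    · exact h.2
    · exact (h.2.1 hv).elim
  have hrun : ∀ y ∈ B (T + 1), y ∉ B T →
      A.run T (bipartiteGraph E) ident ω y = A.run T H ident ω y := by
    intro y hy hy'
    simp only [LocalAlgorithm.run]
    rw [A.state_eq_of_adj_iff (G := bipartiteGraph E) (H := H) (W := Sum.inr '' W)
      (D := 2 * T + 2) ident ω ?_ T (by omega) y (hmono (by omega) hy) hy']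
    rintro (v | c) hy hyW (w | d)
    · simp [hH, not_bipartiteGraph_adj_inl_inl]
    · rw [hH, bipartiteGraph_adj_inl_inr, bipartiteGraph_adj_inl_inr]
      exact ⟨hV v d _ hy, fun h => hE' h⟩
    · rw [hH, bipartiteGraph_adj_inr_inl, bipartiteGraph_adj_inr_inl]
      refine ⟨fun h => hC w c hy (fun hw => hyW ?_) h, fun h => hE' h⟩
      exact Set.mem_image_of_mem _ (hKW w c hw h)
    · simp [hH, not_bipartiteGraph_adj_inr_inr]
  -- Adjoining `K` closes the ball: the partners of nodes of `K` lie in `W`, so `K` itself sends no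
  -- matching edge outside.
  have key := card_sub_card_eq_of_equiv e
    (K ∪ ({v : V | Sum.inl v ∈ B (T + 1)} : Finset V)) ({c : C | Sum.inr c ∈ B (T + 1)} : Finset C)
  rw [Finset.card_union_of_disjoint] at key
  swap
  · rw [Finset.disjoint_left]
    intro v hv hv'
    exact hKB v (hKK' hv) _ (by simpa using hv')
  have h1 : {v ∈ K ∪ ({v : V | Sum.inl v ∈ B (T + 1)} : Finset V) |
      e v ∉ ({c : C | Sum.inr c ∈ B (T + 1)} : Finset C)} =
      ({v : V | Sum.inl v ∈ B (T + 1) ∧ Sum.inl v ∉ B T ∧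
        A.run T H ident ω (Sum.inl v) ∉ ident '' B (T + 1)} : Finset V) := by
    ext v
    simp only [Finset.mem_filter, Finset.mem_union, Finset.mem_univ, true_and]
    have hid : ident (Sum.inr (e v)) ∈ ident '' B (T + 1) ↔ Sum.inr (e v) ∈ B (T + 1) :=
      hident.mem_set_image
    constructor
    · rintro ⟨hv | hv, hev⟩
      · exact (hev (hB0 _ (hKW _ _ hv (heE v)) _)).elim
      · have h' : Sum.inl v ∉ B T := fun h' => hev <| SimpleGraph.mem_reach_succ_of_adj h'
          (bipartiteGraph_adj_inl_inr.2 (hV _ _ _ hv (heE v)))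
        refine ⟨hv, h', ?_⟩
        rwa [← hrun _ hv h', heV, hid]
    · rintro ⟨hv, h', ho⟩
      refine ⟨Or.inr hv, ?_⟩
      rwa [← hrun _ hv h', heV, hid] at ho
  have h2 : {c ∈ ({c : C | Sum.inr c ∈ B (T + 1)} : Finset C) |
      e.symm c ∉ K ∪ ({v : V | Sum.inl v ∈ B (T + 1)} : Finset V)} =
      ({c : C | Sum.inr c ∈ B (T + 1) ∧ Sum.inr c ∉ B T ∧
        A.run T H ident ω (Sum.inr c) ∉ ident '' B (T + 1)} : Finset C) := by
    ext c
    simp only [Finset.mem_filter, Finset.mem_union, Finset.mem_univ, true_and, not_or]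
    have hid : ident (Sum.inl (e.symm c)) ∈ ident '' B (T + 1) ↔
      Sum.inl (e.symm c) ∈ B (T + 1) := hident.mem_set_image
    have hec : (e.symm c, c) ∈ E := by simpa using heE (e.symm c)
    refine and_congr_right fun hc => ?_
    constructor
    · rintro ⟨hK, hv⟩
      have h' : Sum.inr c ∉ B T := fun h' => hv <| SimpleGraph.mem_reach_succ_of_adj h'
          (bipartiteGraph_adj_inr_inl.2 (hC _ _ (hmono (by omega) hc) hK hec))
      refine ⟨h', ?_⟩
      rwa [← hrun _ hc h', heC, hid]
    · rintro ⟨h', ho⟩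
      rw [← hrun _ hc h', heC, hid] at ho
      exact ⟨fun hK => h' (hB0 _ (hKW _ _ hK hec) _), ho⟩
  rw [h1, h2] at key
  rw [matchingExcess, ← hB]
  push_cast at key
  linarith

end Flow

/-! ### Random neighborhoods, total variation and the resulting bound. -/

section RandomBipartite
variable {V C : Type*}

/-- The edges of `E` that have no endpoint in `K`. -/
def edgesOff (K : Finset V) (E : Set (V × C)) : Set (V × C) := {e ∈ E | e.1 ∉ K}

/-- The neighbors of the nodes of `K`. -/
def nbrs (K : Finset V) (E : Set (V × C)) : Set C := {c | ∃ v ∈ K, (v, c) ∈ E}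

variable [Fintype V] [Fintype C] (p : unitInterval)

lemma setBernoulli_real_forall_notMem {ι : Type*} [Fintype ι] (S : Finset ι) :
    (setBernoulli Set.univ p).real {E : Set ι | ∀ i ∈ S, i ∉ E} = (1 - p) ^ S.card := by
  classical
  induction S using Finset.induction_on with
  | empty => simp
  | insert i S hi ih =>
    have h : {E : Set ι | ∀ j ∈ insert i S, j ∉ E} =
        {E : Set ι | i ∈ E}ᶜ ∩ {E : Set ι | ∀ i ∈ S, i ∉ E} := by
      ext; simp
    rw [h, setBernoulli_real_inter_eq_mul p {i}, ih, measureReal_compl .of_discrete,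
      setBernoulli_real_mem, Finset.card_insert_of_notMem hi, pow_succ]
    · simp [mul_comm]
    · simp +contextual
    · intro E E' h hE j hj hj'
      refine hE j hj ((h j ?_).2 hj')
      rintro rfl
      exact hi hj

-- The edges between `K` and each single `c` form disjoint blocks, also disjoint from the edges off
-- `K`, so the neighborhood is a product Bernoulli set independent of `Z`. The factor `1 - (1 - (1 -
-- p) ^ K.card)` stays unsimplified to match the shape `1 - q` used for total variation.
open Classical in
lemma setBernoulli_real_inter_nbrs_eq (K : Finset V) (w : Set C) {Z : Set (Set (V × C))}
    (hZ : ∀ E E' : Set (V × C), edgesOff K E = edgesOff K E' → E ∈ Z → E' ∈ Z) :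
    (setBernoulli Set.univ p).real (Z ∩ {E | nbrs K E = w}) =
      (setBernoulli Set.univ p).real Z *
        ∏ c, if c ∈ w then 1 - (1 - p : ℝ) ^ K.card else 1 - (1 - (1 - p) ^ K.card) := by
  have key : ∀ s : Finset C,
      (setBernoulli Set.univ p).real (Z ∩ {E | ∀ c ∈ s, c ∈ nbrs K E ↔ c ∈ w}) =
      (setBernoulli Set.univ p).real Z *
        ∏ c ∈ s, if c ∈ w then 1 - (1 - p : ℝ) ^ K.card else 1 - (1 - (1 - p) ^ K.card) := by
    intro s
    induction s using Finset.induction_on with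
    | empty => simp
    | insert c s hc ih =>
      have h : Z ∩ {E | ∀ d ∈ insert c s, d ∈ nbrs K E ↔ d ∈ w} =
          {E | c ∈ nbrs K E ↔ c ∈ w} ∩ (Z ∩ {E | ∀ d ∈ s, d ∈ nbrs K E ↔ d ∈ w}) := by
        ext; simp; tauto
      have hnot : (setBernoulli Set.univ p).real {E : Set (V × C) | c ∉ nbrs K E} =
          (1 - p) ^ K.card := by
        have := setBernoulli_real_forall_notMem p (K ×ˢ ({c} : Finset C))
        rw [Finset.card_product, Finset.card_singleton, mul_one] at this
        rw [← this]
        congr 1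
        ext E
        simp [nbrs]
      rw [h, setBernoulli_real_inter_eq_mul p {e | e.1 ∈ K ∧ e.2 = c}, ih,
        Finset.prod_insert hc]
      · have : (setBernoulli Set.univ p).real {E : Set (V × C) | c ∈ nbrs K E ↔ c ∈ w} =
            if c ∈ w then 1 - (1 - p : ℝ) ^ K.card else 1 - (1 - (1 - p) ^ K.card) := by
          split_ifs with hcw
          · rw [← hnot, ← probReal_compl_eq_one_sub .of_discrete]
            congr 1
            ext; simp [hcw]
          · rw [sub_sub_cancel, ← hnot]
            simp [hcw]
        rw [this]; ring
      · intro E E' hEE' hE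
        have : c ∈ nbrs K E ↔ c ∈ nbrs K E' := by
          refine exists_congr fun v => and_congr_right fun hv => hEE' (v, c) ⟨hv, rfl⟩
        simpa [this] using hE
      · rintro E E' hEE' ⟨hE, hE2⟩
        refine ⟨hZ E E' ?_ hE, fun d hd => ?_⟩
        · ext e
          simp only [edgesOff, Set.mem_ofPred_eq]
          refine and_congr_left fun he => hEE' e fun h => he h.1
        · rw [← hE2 d hd]
          refine exists_congr fun v => and_congr_right fun hv => (hEE' (v, d) fun h => ?_).symm
          exact hc (h.2 ▸ hd)
  rw [← key Finset.univ]
  congr 2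
  ext E
  simp [Set.ext_iff]

-- Cauchy–Schwarz bounds the `L¹` distance by the root of the chi-square divergence, and one plus
-- that divergence is multiplicative over the coordinates.
open Classical in
lemma sum_abs_prod_sub_prod_le (q q' : ℝ) (hq : 0 < q) (hq1 : q < 1) :
    ∑ w : Set C, |(∏ c, if c ∈ w then q' else 1 - q') - ∏ c, if c ∈ w then q else 1 - q| ≤
      √((1 + (q' - q) ^ 2 / (q * (1 - q))) ^ Fintype.card C - 1) := by
  set P : ℝ → Finset C → ℝ := fun q w => ∏ c, if c ∈ w then q else 1 - q
  have hP : ∀ q, ∑ w, P q w = 1 := by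
    intro q
    rw [sum_set_prod_ite]; simp
  have hpos : ∀ w, 0 < P q w := fun w => Finset.prod_pos fun c _ => by split_ifs <;> linarith
  rw [← Fintype.finsetEquivSet.sum_comp]
  apply Real.le_sqrt_of_sq_le
  have hCS : (∑ w, |P q' w - P q w|) ^ 2 ≤ (∑ w, (P q' w - P q w) ^ 2 / P q w) * ∑ w, P q w := by
    refine Finset.sum_sq_le_sum_mul_sum_of_sq_le_mul _ (fun w _ => ?_) (fun w _ => (hpos w).le)
      fun w _ => le_of_eq ?_
    · exact div_nonneg (sq_nonneg _) (hpos w).le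
    · rw [sq_abs, div_mul_cancel₀ _ (hpos w).ne']
  have hsq : ∑ w, P q' w ^ 2 / P q w = (1 + (q' - q) ^ 2 / (q * (1 - q))) ^ Fintype.card C := by
    calc _ = ∑ w : Finset C, ∏ c, (if c ∈ w then q' ^ 2 / q else (1 - q') ^ 2 / (1 - q)) := by
          refine Finset.sum_congr rfl fun w _ => ?_
          simp only [P]
          rw [← Finset.prod_pow, ← Finset.prod_div_distrib]
          refine Finset.prod_congr rfl fun c _ => ?_
          split_ifs <;> rfl
      _ = _ := by
          rw [sum_set_prod_ite, Finset.prod_const, Finset.card_univ]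
          congr 1
          have : 1 - q ≠ 0 := by linarith
          field_simp
          ring
  have hsum : ∑ w, (P q' w - P q w) ^ 2 / P q w = ∑ w, P q' w ^ 2 / P q w - 1 := by
    have : ∀ w, (P q' w - P q w) ^ 2 / P q w = P q' w ^ 2 / P q w - 2 * P q' w + P q w := by
      intro w
      have := (hpos w).ne'
      field_simp
      ring
    simp_rw [this]
    rw [Finset.sum_add_distrib, Finset.sum_sub_distrib, ← Finset.mul_sum, hP, hP]
    ring
  rw [hP, mul_one, hsum, hsq] at hCS
  simpa [P] using hCS

/-- With `x = (1 - p) ^ m`, the numerator is `(x * p) ^ 2` and the claim reduces to `x * (1 + m * p)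
≤ 1`, a consequence of Bernoulli's inequality. -/
lemma one_sub_pow_chi_sq_le {p : ℝ} (hp : 0 < p) (hp1 : p < 1) {m : ℕ} (hm : 0 < m) :
    ((1 - (1 - p) ^ (m + 1)) - (1 - (1 - p) ^ m)) ^ 2 /
      ((1 - (1 - p) ^ m) * (1 - (1 - (1 - p) ^ m))) ≤ p / m := by
  have hx : 0 < (1 - p) ^ m := pow_pos (by linarith) m
  have hx1 : (1 - p) ^ m < 1 := pow_lt_one₀ (by linarith) (by linarith) hm.ne'
  have hmul : (1 - p) ^ m * (1 + m * p) ≤ 1 := by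
    calc (1 - p) ^ m * (1 + m * p) ≤ (1 - p) ^ m * (1 + p) ^ m := by
          gcongr
          exact one_add_mul_le_pow (by linarith) m
      _ = (1 - p ^ 2) ^ m := by rw [← mul_pow]; ring
      _ ≤ 1 := pow_le_one₀ (by nlinarith) (by nlinarith)
  have hm' : (0 : ℝ) < m := by exact_mod_cast hm
  rw [pow_succ (1 - p) m, div_le_div_iff₀ (mul_pos (by linarith) (by linarith)) hm']
  set x := (1 - p) ^ m
  have : (1 - x * (1 - p) - (1 - x)) ^ 2 * m = (x * p) * (x * (m * p)) := by ring
  rw [this]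
  have : p * ((1 - x) * (1 - (1 - x))) = (x * p) * (1 - x) := by ring
  rw [this]
  have : 0 < x * p := by positivity
  gcongr
  linarith

/-- The law of the neighborhood of `K`, jointly with the edges off `insert u K`, is close in total
variation to that of the neighborhood of `insert u K`. -/
lemma setBernoulli_real_add_le [DecidableEq V] (hp : 0 < (p : ℝ)) (hp1 : (p : ℝ) < 1)
    {K : Finset V} (hK : K.Nonempty) {u : V} (hu : u ∉ K) (F F' : Set (Set (V × C) × Set C))
    (hF : Disjoint F F') :
    (setBernoulli Set.univ p).real {E | (edgesOff (insert u K) E, nbrs K E) ∈ F} +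
      (setBernoulli Set.univ p).real
        {E | (edgesOff (insert u K) E, nbrs (insert u K) E) ∈ F'} ≤
      1 + √((1 + (p : ℝ) / K.card) ^ Fintype.card C - 1) := by
  classical
  set μ := setBernoulli (Set.univ : Set (V × C)) p
  set q : ℕ → ℝ := fun m => 1 - (1 - p : ℝ) ^ m with hq
  set Q : ℕ → Set C → ℝ := fun m w => ∏ c, if c ∈ w then q m else 1 - q m with hQ
  have hq0 : ∀ m, 0 ≤ q m ∧ q m ≤ 1 := fun m => by
    constructor
    · have := pow_le_one₀ (n := m) (by linarith : 0 ≤ 1 - (p : ℝ)) (by linarith)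
      simp only [hq]; linarith
    · have := pow_nonneg (by linarith : 0 ≤ 1 - (p : ℝ)) m
      simp only [hq]; linarith
  have hQ0 : ∀ m w, 0 ≤ Q m w := fun m w => Finset.prod_nonneg fun c _ => by
    have := hq0 m
    split_ifs <;> linarith
  have hQ1 : ∀ m, ∑ w, Q m w = 1 := fun m => by
    rw [← Fintype.finsetEquivSet.sum_comp]
    simpa [hQ] using sum_set_prod_ite (ι := C) (fun _ => q m) (fun _ => 1 - q m)
  have hedge : ∀ L ⊆ insert u K, ∀ E : Set (V × C),
      edgesOff (insert u K) E = edgesOff (insert u K) (edgesOff L E) := by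
    intro L hL E
    ext e
    simp only [edgesOff, Set.mem_ofPred_eq]
    have := @hL e.1
    tauto
  -- For `L = K` and `L = insert u K` alike, the joint law is a product with the same first factor,
  -- so only the second factors need comparing.
  have hlaw : ∀ L ⊆ insert u K, ∀ F : Set (Set (V × C) × Set C),
      μ.real {E | (edgesOff (insert u K) E, nbrs L E) ∈ F} =
        ∑ h, ∑ w, if (h, w) ∈ F then μ.real {E | edgesOff (insert u K) E = h} * Q L.card w
          else 0 := by
    intro L hL F
    rw [← Fintype.sum_prod_type'
      (f := fun h w => if (h, w) ∈ F then μ.real {E | edgesOff (insert u K) E = h} * Q L.card w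
          else 0), ← Finset.sum_filter]
    have h := sum_measureReal_preimage_singleton (μ := μ)
      (f := fun E => (edgesOff (insert u K) E, nbrs L E)) ({x | x ∈ F} : Finset _)
      (fun _ _ => .of_discrete)
    have h2 : (fun E => (edgesOff (insert u K) E, nbrs L E)) ⁻¹'
      (({x | x ∈ F} : Finset (Set (V × C) × Set C)) : Set (Set (V × C) × Set C)) =
        {E | (edgesOff (insert u K) E, nbrs L E) ∈ F} := by ext; simp
    rw [← h2, ← h]
    refine Finset.sum_congr rfl fun x _ => ?_
    rw [← setBernoulli_real_inter_nbrs_eq p L x.2]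
    · congr 1
      ext E
      simp [Prod.ext_iff]
    · intro E E' hEE' hE
      rw [Set.mem_ofPred_eq] at hE ⊢
      rw [← hE, hedge L hL, hedge L hL E, hEE']
  rw [hlaw K (Finset.subset_insert _ _), hlaw _ subset_rfl, ← Finset.sum_add_distrib]
  have hone : ∑ h, μ.real {E | edgesOff (insert u K) E = h} = 1 := by
    have h := sum_measureReal_preimage_singleton (μ := μ)
      (f := fun E => edgesOff (insert u K) E) Finset.univ (fun _ _ => .of_discrete)
    simp only [Finset.coe_univ, Set.preimage_univ, probReal_univ] at h
    exact h
  rw [Finset.card_insert_of_notMem hu]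
  calc _ ≤ ∑ h, μ.real {E | edgesOff (insert u K) E = h} *
        (1 + √((1 + (p : ℝ) / K.card) ^ Fintype.card C - 1)) := by
        refine Finset.sum_le_sum fun h _ => ?_
        rw [← Finset.sum_add_distrib]
        calc _ ≤ ∑ w, μ.real {E | edgesOff (insert u K) E = h} *
              (Q K.card w + |Q (K.card + 1) w - Q K.card w|) := by
              refine Finset.sum_le_sum fun w _ => ?_
              have hμ : 0 ≤ μ.real {E | edgesOff (insert u K) E = h} := measureReal_nonneg
              have h1 := hQ0 K.card w
              have h2 := hQ0 (K.card + 1) w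
              have h3 := le_abs_self (Q (K.card + 1) w - Q K.card w)
              have h4 := abs_nonneg (Q (K.card + 1) w - Q K.card w)
              by_cases hw : (h, w) ∈ F
              · have hw' : (h, w) ∉ F' := Set.disjoint_left.1 hF hw
                rw [if_pos hw, if_neg hw', add_zero]
                gcongr
                linarith
              · rw [if_neg hw, zero_add]
                split_ifs
                · gcongr; linarith
                · positivity
          _ ≤ _ := by
              rw [← Finset.mul_sum, Finset.sum_add_distrib, hQ1]
              gcongr
              have hKc : 0 < K.card := hK.card_pos
              have hx : 0 < (1 - (p : ℝ)) ^ K.card := pow_pos (by linarith) _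
              have hx1 : (1 - (p : ℝ)) ^ K.card < 1 :=
                pow_lt_one₀ (by linarith) (by linarith) hKc.ne'
              refine (sum_abs_prod_sub_prod_le _ _ (by simp only [hq]; linarith)
                (by simp only [hq]; linarith)).trans ?_
              have hχ := one_sub_pow_chi_sq_le hp hp1 hKc
              refine Real.sqrt_le_sqrt (sub_le_sub_right
                (pow_le_pow_left₀ ?_ (by simpa only [hq] using add_le_add le_rfl hχ) _) 1)
              refine add_nonneg zero_le_one (div_nonneg (sq_nonneg _) (mul_nonneg ?_ ?_))
              · simp only [hq]; linarith
              · simp only [hq]; linarith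
    _ = _ := by rw [← Finset.sum_mul, hone, one_mul]

/-- The set `B E` is independent of the edges at `u`; condition on its value and take a union bound
over its elements. -/
lemma setBernoulli_real_exists_mem_inter_le (u : V) (B : Set (V × C) → Set C)
    (hB : ∀ E E' : Set (V × C), (∀ e, e.1 ≠ u → (e ∈ E ↔ e ∈ E')) → B E = B E') (m : ℕ) :
    (setBernoulli Set.univ p).real {E | (∃ c ∈ B E, (u, c) ∈ E) ∧ (B E).ncard ≤ m} ≤ p * m := by
  classical
  set μ := setBernoulli (Set.univ : Set (V × C)) p
  have hone : ∑ b, μ.real {E | B E = b} = 1 := by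
    have h := sum_measureReal_preimage_singleton (μ := μ)
      (f := B) Finset.univ (fun _ _ => .of_discrete)
    simp only [Finset.coe_univ, Set.preimage_univ, probReal_univ] at h
    exact h
  have hsub : {E | (∃ c ∈ B E, (u, c) ∈ E) ∧ (B E).ncard ≤ m} ⊆
      ⋃ b ∈ ({b : Set C | b.ncard ≤ m} : Finset (Set C)), ⋃ c ∈ b.toFinset,
        ({E | (u, c) ∈ E} ∩ {E | B E = b}) := by
    rintro E ⟨⟨c, hc, hE⟩, hm⟩
    simp only [Set.mem_iUnion]
    exact ⟨B E, by simpa using hm, c, by simpa using hc, hE, rfl⟩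
  refine (measureReal_mono hsub (measure_ne_top _ _)).trans
    ((measureReal_biUnion_finset_le _ _).trans ?_)
  calc _ ≤ ∑ b ∈ ({b : Set C | b.ncard ≤ m} : Finset (Set C)), μ.real {E | B E = b} * (p * m) := by
        refine Finset.sum_le_sum fun b hb => ?_
        refine (measureReal_biUnion_finset_le _ _).trans ?_
        have : ∀ c ∈ b.toFinset, μ.real ({E | (u, c) ∈ E} ∩ {E | B E = b}) ≤
            p * μ.real {E | B E = b} := by
          intro c _
          rw [setBernoulli_real_inter_eq_mul p {(u, c)}, setBernoulli_real_mem]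
          · exact fun E E' h => (h _ rfl).1
          · intro E E' h hE
            rw [Set.mem_ofPred_eq] at hE ⊢
            rw [← hE]
            refine (hB _ _ fun e he => h e ?_).symm
            rintro rfl
            exact he rfl
        refine (Finset.sum_le_card_nsmul _ _ _ this).trans ?_
        have hm : (b.toFinset.card : ℝ) ≤ m := by
          rw [← Set.ncard_eq_toFinset_card']
          exact_mod_cast (by simpa using hb)
        have hp0 := p.2.1
        rw [nsmul_eq_mul]
        calc _ ≤ (m : ℝ) * (p * μ.real {E | B E = b}) := by gcongr
          _ = _ := by ring
    _ ≤ ∑ b, μ.real {E | B E = b} * (p * m) := by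
        have hp0 := p.2.1
        exact Finset.sum_le_sum_of_subset_of_nonneg (Finset.subset_univ _)
          fun b _ _ => by positivity
    _ = _ := by rw [← Finset.sum_mul, hone, one_mul]

/-- All degrees of the bipartite graph are at most `d`. -/
def DegreesLE (d : ℕ) (E : Set (V × C)) : Prop :=
  (∀ v, {c | (v, c) ∈ E}.ncard ≤ d) ∧ ∀ c, {v | (v, c) ∈ E}.ncard ≤ d

lemma setBernoulli_real_not_degreesLE_le (d : ℕ) :
    (setBernoulli Set.univ p).real {E : Set (V × C) | ¬ DegreesLE d E} ≤
      Fintype.card V * ((1 + p) ^ Fintype.card C / 2 ^ d) +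
        Fintype.card C * ((1 + p) ^ Fintype.card V / 2 ^ d) := by
  have hV : ∀ (E : Set (V × C)) v, {c | (v, c) ∈ E}.ncard = (E ∩ {e | e.1 = v}).ncard := by
    intro E v
    rw [← Set.ncard_image_of_injective {c | (v, c) ∈ E} (Prod.mk_right_injective v)]
    congr 1
    ext ⟨a, b⟩
    simp; aesop
  have hC : ∀ (E : Set (V × C)) c, {v | (v, c) ∈ E}.ncard = (E ∩ {e | e.2 = c}).ncard := by
    intro E c
    rw [← Set.ncard_image_of_injective {v | (v, c) ∈ E} (Prod.mk_left_injective c)]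
    congr 1
    ext ⟨a, b⟩
    simp; aesop
  have hV' : ∀ v : V, {e : V × C | e.1 = v}.ncard = Fintype.card C := by
    intro v
    have := hV Set.univ v
    simpa [Set.ncard_univ] using this.symm
  have hC' : ∀ c : C, {e : V × C | e.2 = c}.ncard = Fintype.card V := by
    intro c
    have := hC Set.univ c
    simpa [Set.ncard_univ] using this.symm
  have hsub : {E : Set (V × C) | ¬ DegreesLE d E} ⊆
      (⋃ v ∈ Finset.univ, {E | d < (E ∩ {e | e.1 = v}).ncard}) ∪
        ⋃ c ∈ Finset.univ, {E | d < (E ∩ {e | e.2 = c}).ncard} := by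
    intro E hE
    simp only [DegreesLE, Set.mem_ofPred_eq, not_and_or, not_forall, not_le, hV, hC] at hE
    simpa using hE
  refine (measureReal_mono hsub).trans ((measureReal_union_le _ _).trans (add_le_add ?_ ?_))
  · refine (measureReal_biUnion_finset_le _ _).trans ?_
    refine (Finset.sum_le_card_nsmul _ _ _ fun v _ => setBernoulli_real_lt_ncard_inter_le p _ d
      |>.trans_eq (by rw [hV'])).trans_eq ?_
    rw [nsmul_eq_mul, Finset.card_univ]
  · refine (measureReal_biUnion_finset_le _ _).trans ?_
    refine (Finset.sum_le_card_nsmul _ _ _ fun v _ => setBernoulli_real_lt_ncard_inter_le p _ d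
      |>.trans_eq (by rw [hC'])).trans_eq ?_
    rw [nsmul_eq_mul, Finset.card_univ]

lemma DegreesLE.ncard_reach_le {d : ℕ} {E : Set (V × C)} (h : DegreesLE d E)
    (K K' : Finset V) (j : ℕ) :
    {c | Sum.inr c ∈ (bipartiteGraph (edgesOff K' E)).reach (Sum.inr '' nbrs K E) j}.ncard ≤
      K.card * d * (d + 1) ^ j := by
  classical
  have hdeg : ∀ x, ((bipartiteGraph (edgesOff K' E)).neighborSet x).ncard ≤ d := by
    rintro (v | c)
    · have : (bipartiteGraph (edgesOff K' E)).neighborSet (Sum.inl v) ⊆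
          Sum.inr '' {c | (v, c) ∈ E} := by
        rintro (w | c) h
        · exact (not_bipartiteGraph_adj_inl_inl h).elim
        · exact ⟨c, (bipartiteGraph_adj_inl_inr.1 h).1, rfl⟩
      exact (Set.ncard_le_ncard this).trans ((Set.ncard_image_le (Set.toFinite _)).trans (h.1 v))
    · have : (bipartiteGraph (edgesOff K' E)).neighborSet (Sum.inr c) ⊆
          Sum.inl '' {v | (v, c) ∈ E} := by
        rintro (v | c) h
        · exact ⟨v, (bipartiteGraph_adj_inr_inl.1 h).1, rfl⟩
        · exact (not_bipartiteGraph_adj_inr_inr h).elim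
      exact (Set.ncard_le_ncard this).trans ((Set.ncard_image_le (Set.toFinite _)).trans (h.2 c))
  have hn : (nbrs K E).ncard ≤ K.card * d := by
    have : nbrs K E = ⋃ v ∈ K, {c | (v, c) ∈ E} := by ext; simp [nbrs]
    rw [this, ← smul_eq_mul]
    exact (Finset.set_ncard_biUnion_le _ _).trans
      (Finset.sum_le_card_nsmul _ _ _ fun v _ => h.1 v)
  calc _ ≤ ((bipartiteGraph (edgesOff K' E)).reach (Sum.inr '' nbrs K E) j).ncard := by
        refine Set.ncard_le_ncard_of_injOn Sum.inr (fun c hc => hc) Sum.inr_injective.injOn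
    _ ≤ (Sum.inr '' nbrs K E : Set (V ⊕ C)).ncard * (d + 1) ^ j :=
        SimpleGraph.ncard_reach_le hdeg j
    _ ≤ _ := by
        gcongr
        exact (Set.ncard_image_le (Set.toFinite _)).trans hn

/-- Success is counted twice, through the disjoint events that the excess is `m` and that it is `m +
1`. The error terms are the total variation distance, the chance that `u` meets a ball of bounded
size, and the chance of a large degree. -/
theorem two_mul_setBernoulli_real_outputsPerfectMatching_le {Ω S M : Type*}
    (A : LocalAlgorithm Ω S M) (T : ℕ) {ident : V ⊕ C → ℕ} (hident : ident.Injective)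
    (ω : V ⊕ C → Ω) (hp : 0 < (p : ℝ)) (hp1 : (p : ℝ) < 1) {m : ℕ} (hm : 0 < m)
    (hmV : m < Fintype.card V) (d : ℕ) :
    2 * (setBernoulli Set.univ p).real {E : Set (V × C) |
        OutputsPerfectMatching (bipartiteGraph E) ident
          (A.run T (bipartiteGraph E) ident ω)} ≤
      1 + √((1 + (p : ℝ) / m) ^ Fintype.card C - 1) +
        p * (m * d * (d + 1) ^ (2 * T + 2) : ℕ) +
        (Fintype.card V * ((1 + p) ^ Fintype.card C / 2 ^ d) +
          Fintype.card C * ((1 + p) ^ Fintype.card V / 2 ^ d)) := by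
  classical
  obtain ⟨K, -, hK⟩ := Finset.exists_subset_card_eq
    (show m ≤ (Finset.univ : Finset V).card by rw [Finset.card_univ]; omega)
  obtain ⟨u, hu⟩ : ∃ u, u ∉ K := by
    by_contra! h
    rw [Finset.eq_univ_iff_forall.2 h, Finset.card_univ] at hK
    omega
  set μ := setBernoulli (Set.univ : Set (V × C)) p
  set succ := {E : Set (V × C) | OutputsPerfectMatching (bipartiteGraph E) ident
    (A.run T (bipartiteGraph E) ident ω)}
  set Φ : Set (V × C) × Set C → ℤ := fun x =>
    matchingExcess T ident (A.run T (bipartiteGraph x.1) ident ω) (bipartiteGraph x.1)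
      (Sum.inr '' x.2)
  set B : Set (V × C) → Set C := fun E => {c | Sum.inr c ∈
    (bipartiteGraph (edgesOff (insert u K) E)).reach (Sum.inr '' nbrs K E) (2 * T + 2)} with hB
  have hsub' : ∀ E : Set (V × C), edgesOff (insert u K) E ⊆ E := fun E e he => he.1
  have h1 : succ ⊆ ({E | (edgesOff (insert u K) E, nbrs K E) ∈ {x | Φ x = m}} ∪
      {E | (∃ c ∈ B E, (u, c) ∈ E) ∧ (B E).ncard ≤ m * d * (d + 1) ^ (2 * T + 2)}) ∪
      {E | ¬ DegreesLE d E} := by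
    intro E hE
    by_cases hd : DegreesLE d E
    · refine Or.inl ?_
      by_cases hb : ∃ c ∈ B E, (u, c) ∈ E
      · exact Or.inr ⟨hb, hK ▸ hd.ncard_reach_le K (insert u K) _⟩
      · refine Or.inl ?_
        push Not at hb
        have := card_eq_matchingExcess A T hident ω (hsub' E) (Finset.subset_insert u K)
          (fun e he => he.2) (W := nbrs K E) (fun e he he' => ?_) hE
        · rw [hK] at this
          exact this.symm
        · have heK : e.1 ∈ insert u K := by
            by_contra h
            exact he' ⟨he, h⟩
          by_cases h : e.1 ∈ K
          · exact Or.inl ⟨h, e.1, h, he⟩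
          · refine Or.inr ⟨heK, h, fun hc => hb e.2 hc ?_⟩
            rw [← (Finset.mem_insert.1 heK).resolve_right h]
            exact he
    · exact Or.inr hd
  -- Here every deleted edge ends in `W`, so no exceptional event is needed.
  have h2 : succ ⊆ {E | (edgesOff (insert u K) E, nbrs (insert u K) E) ∈
      {x | Φ x = m + 1}} := by
    intro E hE
    have := card_eq_matchingExcess A T hident ω (hsub' E) (subset_refl (insert u K))
          (fun e he => he.2) (W := nbrs (insert u K) E) (fun e he he' => ?_) hE
    · rw [Finset.card_insert_of_notMem hu, hK] at this
      push_cast at this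
      exact this.symm
    · have heK : e.1 ∈ insert u K := by
        by_contra h
        exact he' ⟨he, h⟩
      exact Or.inl ⟨heK, e.1, heK, he⟩
  have h3 := setBernoulli_real_add_le p hp hp1 (Finset.card_pos.1 (hK ▸ hm)) hu
    {x : Set (V × C) × Set C | Φ x = m} {x | Φ x = m + 1} (by
      rw [Set.disjoint_left]
      intro x hx hx'
      rw [Set.mem_ofPred_eq] at hx hx'
      omega)
  have h4 := setBernoulli_real_exists_mem_inter_le p u B (fun E E' h => ?_)
    (m * d * (d + 1) ^ (2 * T + 2))
  · have h5 := setBernoulli_real_not_degreesLE_le (V := V) (C := C) p d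
    have h6 := (measureReal_mono (μ := μ) h1).trans ((measureReal_union_le _ _).trans
      (add_le_add_left (measureReal_union_le _ _) _))
    have h7 := measureReal_mono (μ := μ) h2
    rw [hK] at h3
    linarith
  · have hn : nbrs K E = nbrs K E' := by
      ext c
      refine exists_congr fun v => and_congr_right fun hv => h _ ?_
      rintro rfl
      exact hu hv
    have he : edgesOff (insert u K) E = edgesOff (insert u K) E' := by
      ext e
      refine and_congr_left fun hv => h _ ?_
      rintro rfl
      exact hv (Finset.mem_insert_self _ _)
    simp only [hB, hn, he]

end RandomBipartite

/-! ### Averaging over the random tapes. -/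

/-- Fubini, integrating over the graph first. The success event is measurable because there are
finitely many graphs and the output vectors form a discrete space. -/
lemma perfectMatchingProb_le {Ω S M : Type*} [MeasurableSpace Ω] (ρ : Measure Ω)
    [IsProbabilityMeasure ρ] (A : LocalAlgorithm Ω S M) (T n : ℕ) (p : unitInterval)
    (ident : Fin n ⊕ Fin n → ℕ)
    (hA : ∀ (E : Set (Fin n × Fin n)) (v : Fin n ⊕ Fin n),
      Measurable fun ω : Fin n ⊕ Fin n → Ω => A.run T (bipartiteGraph E) ident ω v) {b : ℝ}
    (hb : ∀ ω : Fin n ⊕ Fin n → Ω, (setBernoulli Set.univ p).real {E : Set (Fin n × Fin n) |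
        OutputsPerfectMatching (bipartiteGraph E) ident
          (A.run T (bipartiteGraph E) ident ω)} ≤ b) :
    perfectMatchingProb ρ A T n p ident ≤ b := by
  have hmeas : MeasurableSet {x : Set (Fin n × Fin n) × (Fin n ⊕ Fin n → Ω) |
      OutputsPerfectMatching (bipartiteGraph x.1) ident
        (A.run T (bipartiteGraph x.1) ident x.2)} := by
    have : {x : Set (Fin n × Fin n) × (Fin n ⊕ Fin n → Ω) |
      OutputsPerfectMatching (bipartiteGraph x.1) ident
        (A.run T (bipartiteGraph x.1) ident x.2)} = ⋃ E : Set (Fin n × Fin n),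
        ({E} : Set (Set (Fin n × Fin n))) ×ˢ ((fun ω => A.run T (bipartiteGraph E) ident ω) ⁻¹'
          {out | OutputsPerfectMatching (bipartiteGraph E) ident out}) := by
      ext ⟨E, ω⟩
      simp
    rw [this]
    refine MeasurableSet.iUnion fun E => .prod (.singleton E) ?_
    exact measurable_pi_iff.2 (hA E) .of_discrete
  obtain ⟨ω₀⟩ : Nonempty (Fin n ⊕ Fin n → Ω) :=
    ⟨fun _ => (nonempty_of_isProbabilityMeasure ρ).some⟩
  have hb0 : 0 ≤ b := measureReal_nonneg.trans (hb ω₀)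
  rw [perfectMatchingProb, measureReal_def]
  refine ENNReal.toReal_le_of_le_ofReal hb0 ?_
  rw [Measure.prod_apply_symm hmeas]
  calc _ ≤ ∫⁻ _ : Fin n ⊕ Fin n → Ω, ENNReal.ofReal b ∂Measure.pi fun _ => ρ := by
        refine lintegral_mono fun ω => ?_
        rw [ENNReal.le_ofReal_iff_toReal_le (measure_ne_top _ _) hb0]
        exact hb ω
    _ = _ := by simp

/-! ### Estimates of the error terms, with `L = log n`. -/

section Asymptotics

lemma eventually_log_pow_mul_exp_neg_lt (K : ℝ) (j : ℕ) :
    ∀ᶠ n : ℕ in Filter.atTop, 13 ≤ Real.log n ∧ K ≤ Real.log n ∧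
      Real.log n ^ j * Real.exp (-(Real.log n / 2)) < 1 / 9 := by
  have hlog : Filter.Tendsto (fun n : ℕ => Real.log n) Filter.atTop Filter.atTop :=
    Real.tendsto_log_atTop.comp tendsto_natCast_atTop_atTop
  have h : Filter.Tendsto (fun x : ℝ => x ^ j * Real.exp (-(x / 2))) Filter.atTop (nhds 0) := by
    have := (Real.tendsto_pow_mul_exp_neg_atTop_nhds_zero j).comp
      (Filter.tendsto_id.atTop_div_const (two_pos (α := ℝ)))
    have := this.const_mul (2 ^ j)
    rw [mul_zero] at this
    refine this.congr fun x => ?_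
    simp only [Function.comp_apply, id, div_pow]
    field_simp
  exact (hlog.eventually_ge_atTop 13).and ((hlog.eventually_ge_atTop K).and
    (hlog.eventually (h.eventually_lt_const (by norm_num))))

lemma sqrt_one_add_div_pow_sub_one_le {L p m : ℝ} {n k : ℕ} (hL : 13 ≤ L) (hp : 0 ≤ p)
    (hnp : n * p ≤ L ^ (k + 1)) (hm : L ^ (k + 3) ≤ m) :
    √((1 + p / m) ^ n - 1) ≤ 1 / 9 := by
  have hL0 : 0 < L := by linarith
  have hm0 : 0 < m := lt_of_lt_of_le (by positivity) hm
  have h1 : n * (p / m) ≤ 1 / L ^ 2 := by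
    rw [← mul_div_assoc]
    calc n * p / m ≤ L ^ (k + 1) / L ^ (k + 3) := by gcongr
      _ = 1 / L ^ 2 := by rw [div_eq_div_iff (by positivity) (by positivity)]; ring
  have h2 : 1 / L ^ 2 ≤ 1 / 13 ^ 2 := by gcongr
  have h3 : (1 + p / m) ^ n ≤ Real.exp (1 / 13 ^ 2) := by
    calc (1 + p / m) ^ n ≤ Real.exp (p / m) ^ n := by
          gcongr
          rw [add_comm]
          exact Real.add_one_le_exp _
      _ = Real.exp (n * (p / m)) := by rw [Real.exp_nat_mul]
      _ ≤ _ := by gcongr; linarith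
  -- The threshold `13` is chosen so that `2 / 13 ^ 2 ≤ (1 / 9) ^ 2`.
  have h4 : |Real.exp (1 / 13 ^ 2) - 1| ≤ 2 * |(1 / 13 ^ 2 : ℝ)| :=
    Real.abs_exp_sub_one_le (by norm_num [abs_le])
  rw [Real.sqrt_le_left (by norm_num)]
  have h5 := (le_abs_self _).trans h4
  rw [abs_of_pos (by positivity)] at h5
  norm_num at h5 h3 ⊢
  linarith

lemma mul_one_add_pow_div_two_pow_le {L p : ℝ} {n k d : ℕ} (hL : 13 ≤ L) (hn : (n : ℝ) = Real.exp L)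
    (hp : 0 ≤ p) (hnp : n * p ≤ L ^ (k + 1)) (hd : L ^ (k + 3) ≤ d) :
    n * ((1 + p) ^ n / 2 ^ d) ≤ 1 / 18 := by
  have hL0 : 0 < L := by linarith
  have h1 : (1 + p) ^ n ≤ Real.exp (L ^ (k + 1)) := by
    calc (1 + p) ^ n ≤ Real.exp p ^ n := by
          gcongr
          rw [add_comm]
          exact Real.add_one_le_exp _
      _ = Real.exp (n * p) := by rw [Real.exp_nat_mul]
      _ ≤ _ := by gcongr
  have h2 : (2 : ℝ) ^ d = Real.exp (d * Real.log 2) := by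
    rw [mul_comm, Real.exp_mul, Real.exp_log two_pos, Real.rpow_natCast]
  have h3 : L + L ^ (k + 1) - d * Real.log 2 ≤ -L := by
    have hlog := Real.log_two_gt_d9
    have : L ≤ L ^ (k + 1) := le_self_pow₀ (by linarith) (by omega)
    have h4 : L ^ (k + 3) = L ^ 2 * L ^ (k + 1) := by ring
    have h5 : 6 * L ^ (k + 1) ≤ L ^ (k + 3) := by
      rw [h4]; gcongr; nlinarith
    have h6 : L ^ (k + 3) * (1 / 2) ≤ d * Real.log 2 := by gcongr; linarith
    linarith
  calc n * ((1 + p) ^ n / 2 ^ d) ≤ Real.exp L * (Real.exp (L ^ (k + 1)) / 2 ^ d) := by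
        rw [hn]; gcongr
    _ = Real.exp (L + L ^ (k + 1) - d * Real.log 2) := by
        rw [h2, Real.exp_sub, Real.exp_add, mul_div_assoc]
    _ ≤ Real.exp (-13) := by gcongr; linarith
    _ ≤ 1 / 18 := by
        rw [Real.exp_neg, one_div]
        gcongr
        have := Real.quadratic_le_exp_of_nonneg (show (0 : ℝ) ≤ 13 by norm_num)
        norm_num at this
        linarith

/-- The bound on `T` makes `(d + 1) ^ (2 * T)` at most `√n`. The other four factors `d + 1` and the
bound on `n * p` give the exponent `4 * (k + 4) + (k + 1) = 5 * k + 17`. -/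
lemma mul_pow_lt_of_lt_log_div_loglog {L p : ℝ} {n k d T : ℕ} (hL : 13 ≤ L)
    (hn : (n : ℝ) = Real.exp L) (hnp : n * p ≤ L ^ (k + 1))
    (hd : (d : ℝ) + 1 ≤ L ^ (k + 4)) (hLn : L ^ (5 * k + 17) * Real.exp (-(L / 2)) < 1 / 9)
    (hT : T < 1 / (4 * (k + 4)) * (L / Real.log L)) :
    p * (d * d * (d + 1) ^ (2 * T + 2) : ℕ) < 1 / 9 := by
  have hL0 : 0 < L := by linarith
  have hlogL : 0 < Real.log L := Real.log_pos (by linarith)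
  have h1 : L ^ ((k + 4) * (2 * T)) ≤ Real.exp (L / 2) := by
    have : L ^ ((k + 4) * (2 * T)) = Real.exp (Real.log L * ((k + 4) * (2 * T))) := by
      rw [Real.exp_mul, Real.exp_log hL0]
      exact_mod_cast rfl
    rw [this]
    gcongr
    have h : (1 : ℝ) / (4 * (k + 4)) * (L / Real.log L) = L / (4 * (k + 4) * Real.log L) := by
      field_simp
    rw [h, lt_div_iff₀ (by positivity)] at hT
    nlinarith
  have hexp : 0 < Real.exp L := Real.exp_pos L
  have hp' : p ≤ L ^ (k + 1) * Real.exp (-L) := by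
    rw [Real.exp_neg, ← div_eq_mul_inv, le_div_iff₀ hexp, ← hn]
    linarith
  calc p * (d * d * (d + 1) ^ (2 * T + 2) : ℕ)
      ≤ L ^ (k + 1) * Real.exp (-L) * ((d + 1) * (d + 1) * (d + 1) ^ (2 * T + 2)) := by
        push_cast
        gcongr <;> linarith
    _ = L ^ (k + 1) * Real.exp (-L) * (d + 1) ^ (2 * T + 4) := by ring
    _ ≤ L ^ (k + 1) * Real.exp (-L) * (L ^ (k + 4)) ^ (2 * T + 4) := by gcongr
    _ = L ^ (5 * k + 17) * Real.exp (-L) * L ^ ((k + 4) * (2 * T)) := by ring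
    _ ≤ L ^ (5 * k + 17) * Real.exp (-L) * Real.exp (L / 2) := by gcongr
    _ = L ^ (5 * k + 17) * Real.exp (-(L / 2)) := by
        rw [mul_assoc, ← Real.exp_add]; ring_nf
    _ < 1 / 9 := hLn

end Asymptotics

theorem mainTheorem3 :
    ∃ α : ℝ, 0 < α ∧
      ∀ (k : ℕ) (K : ℝ), ∃ c : ℝ, 0 < c ∧ ∃ n₀ : ℕ, ∀ n : ℕ, n₀ ≤ n →
        ∀ p : unitInterval,
          α * Real.log n / n ≤ (p : ℝ) → (p : ℝ) ≤ K * Real.log n ^ k / n →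
        ∀ ident : Fin n ⊕ Fin n → ℕ, Function.Injective ident →
        ∀ (Ω S M : Type*) [MeasurableSpace Ω] (ρ : Measure Ω) [IsProbabilityMeasure ρ]
          (A : LocalAlgorithm Ω S M) (T : ℕ),
          -- the output of every node is a random variable
          (∀ (E : Set (Fin n × Fin n)) (v : Fin n ⊕ Fin n),
            Measurable fun ω : Fin n ⊕ Fin n → Ω => A.run T (bipartiteGraph E) ident ω v) →
          2 / 3 ≤ perfectMatchingProb ρ A T n p ident →
            c * (Real.log n / Real.log (Real.log n)) ≤ (T : ℝ) := by
  -- Any `α > 0` would do, as the lower bound on `p` serves only to give `0 < p`.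
  refine ⟨1, one_pos, fun k K => ⟨1 / (4 * (k + 4)), by positivity, ?_⟩⟩
  obtain ⟨n₀, hn₀⟩ := Filter.eventually_atTop.1
    (eventually_log_pow_mul_exp_neg_lt K (5 * k + 17))
  refine ⟨n₀, fun n hn p hp hpK ident hident Ω S M _ ρ _ A T hA hprob => ?_⟩
  obtain ⟨hL, hKL, hLn⟩ := hn₀ n hn
  by_contra! hT
  set L := Real.log n with hLdef
  have hL0 : 0 < L := by linarith
  have hn0 : (0 : ℝ) < n := by
    rcases Nat.eq_zero_or_pos n with rfl | h
    · simp [hLdef] at hL0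
    · exact_mod_cast h
  have hnL : (n : ℝ) = Real.exp L := (Real.exp_log hn0).symm
  have hp0 : 0 < (p : ℝ) := lt_of_lt_of_le (by positivity) hp
  have hnp : n * (p : ℝ) ≤ L ^ (k + 1) := by
    rw [le_div_iff₀ hn0] at hpK
    calc n * (p : ℝ) ≤ K * L ^ k := by linarith
      _ ≤ L * L ^ k := by gcongr
      _ = _ := by ring
  have hpow : L ^ (5 * k + 17) < n := by
    have h1 : Real.exp (-(L / 2)) = Real.exp (L / 2) / n := by
      rw [hnL, ← Real.exp_sub]; ring_nf
    have h2 : 1 ≤ Real.exp (L / 2) := Real.one_le_exp (by positivity)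
    rw [h1, ← mul_div_assoc, div_lt_iff₀ hn0] at hLn
    have h3 : L ^ (5 * k + 17) * 1 ≤ L ^ (5 * k + 17) * Real.exp (L / 2) := by gcongr
    linarith
  have hp1 : (p : ℝ) < 1 := by
    have h : L ^ (k + 1) ≤ L ^ (5 * k + 17) := pow_le_pow_right₀ (by linarith) (by omega)
    by_contra! h'
    nlinarith
  -- One number serves as both the size of `K` and the degree bound. It exceeds `n * p ≤ L ^ (k +
  -- 1)` by a factor `L ^ 2`, which makes both the total variation and the degree error small.
  set d := ⌈L ^ (k + 3)⌉₊ with hd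
  have hd1 : L ^ (k + 3) ≤ d := Nat.le_ceil _
  have hd0 : 0 < d := Nat.ceil_pos.2 (by positivity)
  have hd2 : (d : ℝ) + 1 ≤ L ^ (k + 4) := by
    have h1 : (d : ℝ) < L ^ (k + 3) + 1 := Nat.ceil_lt_add_one (by positivity)
    have h2 : 1 ≤ L ^ (k + 3) := one_le_pow₀ (by linarith)
    have h3 : 13 * L ^ (k + 3) ≤ L * L ^ (k + 3) := by gcongr
    have h4 : L ^ (k + 4) = L * L ^ (k + 3) := by ring
    linarith
  have hdn : d < Fintype.card (Fin n) := by
    rw [Fintype.card_fin]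
    have h : L ^ (k + 4) ≤ L ^ (5 * k + 17) := pow_le_pow_right₀ (by linarith) (by omega)
    have : (d : ℝ) < n := by linarith
    exact_mod_cast this
  have h1 := sqrt_one_add_div_pow_sub_one_le hL hp0.le hnp hd1
  have h2 := mul_one_add_pow_div_two_pow_le hL hnL hp0.le hnp hd1
  have h3 := mul_pow_lt_of_lt_log_div_loglog hL hnL hnp hd2 hLn hT
  have h4 := perfectMatchingProb_le ρ A T n p ident hA fun ω =>
    (le_div_iff₀' two_pos).2 <|
      two_mul_setBernoulli_real_outputsPerfectMatching_le p A T hident ω hp0 hp1 hd0 hdn d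
  rw [Fintype.card_fin] at h4
  -- The errors sum to less than `1 / 9 + 1 / 9 + 2 / 18 = 1 / 3`, so twice the success probability
  -- is below `4 / 3`.
  linarith
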